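/- Let $\mathbf\Lambda$ be the set of all partitions and let $\mathcal S=\mathbb C[\pi_\lambda \mid \lambda\in\mathbf\Lambda]$ be the polynomial ring in infinitely many indeterminates labelled by partitions. For integers $0\le k\le n$ let $\mathbf\Lambda_{k,n}\subset\mathbf\Lambda$ be the set of partitions whose Young diagram fits into the $k\times(n-k)$ rectangle, and let $\mathcal S_{k,n}=\mathbb C[\pi_\lambda\mid\lambda\in\mathbf\Lambda_{k,n}]\subset\mathcal S$. For a $k$-tuple $L=(L_1,\dots,L_k)$ of integers with $-k\le L_i\le n-k-1$, put $\widetilde\pi_L:=0$ if $L$ has repeated entries, and otherwise $\widetilde\pi_L:=\operatorname{sgn}(L)\,\pi_\lambda$, where $\operatorname{sgn}(L)$ is the sign of the permutation that puts $L$ into increasing order $L'_1<\dots<L'_k$ and $\lambda\in\mathbf\Lambda_{k,n}$ is the partition with parts $\lambda_i=L'_{k-i+1}+i$, $1\le i\le k$. Let $\mathcal I_{k,n}\subset\mathcal S_{k,n}$ be the ideal generated by the Plücker quadratic forms $$p_{I,J}=\sum_{j=1}^{k+1}(-1)^j\,\widetilde\pi_{I_1,\dots,I_{k-1},J_j}\,\widetilde\pi_{J_1,\dots,\widehat{J_j},\dots,J_{k+1}},$$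 where $I$ runs over all $(k-1)$-tuples and $J$ over all $(k+1)$-tuples of integers between $-k$ and $n-k-1$ (for $k=0$ there are no such forms and $\mathcal I_{0,n}=0$). Let $$\mathcal I=\Big\langle\bigcup_{0\le k\le n}\mathcal I_{k,n}\Big\rangle\subset\mathcal S$$ be the ideal of $\mathcal S$ generated by all Plücker relations. Then $\mathcal I$ is a prime ideal; hence $\mathcal S/\mathcal I$, the coordinate ring of the infinite-dimensional Grassmannian, is an integral domain. -/

import Mathlib

noncomputable section

namespace InfGrassmannian

/-- The indices `ℓ` with `-k ≤ ℓ ≤ n - k - 1`, labelling the basis of `ℋ_{k,n} = V_k ⊕ V_{n-k}^*`. -/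
abbrev Idx (k n : ℕ) : Type := Set.Icc (-(k : ℤ)) ((n : ℤ) - k - 1)

/-- The increasing rearrangement of a tuple of indices. -/
def increasing {k n : ℕ} (L : Fin k → Idx k n) : Fin k → Idx k n := L ∘ Tuple.sort L

/-- The sign of the permutation that puts `L` into increasing order, and `0` if `L` has repeated
indices. -/
def sgn {k n : ℕ} (L : Fin k → Idx k n) : ℤ :=
  open Classical in
  if Function.Injective L then ((Equiv.Perm.sign (Tuple.sort L) : ℤˣ) : ℤ) else 0

/-- The parts `λ_i = L_{k-i+1} + i` (`1 ≤ i ≤ k`) of the partition of the increasing rearrangement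
of `L`; the index of the code starts at `0`, that is, `i` stands for `i + 1`. The integers in
question are nonnegative, see `part_eq`. -/
def part {k n : ℕ} (L : Fin k → Idx k n) (i : Fin k) : ℕ :=
  ((increasing L i.rev : ℤ) + i + 1).toNat

theorem increasing_strictMono {k n : ℕ} {L : Fin k → Idx k n} (hL : Function.Injective L) :
    StrictMono (increasing L) :=
  (Tuple.monotone_sort L).strictMono_of_injective (hL.comp (Tuple.sort L).injective)

theorem increasing_gap {k n : ℕ} {L : Fin k → Idx k n} (hL : Function.Injective L) {i j : Fin k}
    (h : i ≤ j) : (increasing L i : ℤ) + ((j : ℕ) - (i : ℕ) : ℤ) ≤ increasing L j := by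
  obtain ⟨i, hi⟩ := i
  obtain ⟨j, hj⟩ := j
  simp only [Fin.mk_le_mk] at h
  induction j, h using Nat.le_induction with
  | base => simp
  | succ m hm ih =>
    have h1 := ih (by omega)
    have h2 : (increasing L ⟨m, by omega⟩ : ℤ) < increasing L ⟨m + 1, hj⟩ :=
      increasing_strictMono hL (Fin.mk_lt_mk.2 (Nat.lt_succ_self m))
    push_cast at *
    omega

theorem part_eq {k n : ℕ} {L : Fin k → Idx k n} (hL : Function.Injective L) (i : Fin k) :
    (part L i : ℤ) = (increasing L i.rev : ℤ) + i + 1 := by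
  have h0 : 0 < k := i.pos
  have h := increasing_gap hL (i := ⟨0, h0⟩) (j := i.rev) (Nat.zero_le _)
  have h1 := (increasing L ⟨0, h0⟩).2.1
  simp only [Fin.val_rev] at h
  rw [part, Int.toNat_of_nonneg]
  omega

theorem part_le {k n : ℕ} {L : Fin k → Idx k n} (hL : Function.Injective L) (i : Fin k) :
    part L i + k ≤ n := by
  have h0 : 0 < k := i.pos
  have h := increasing_gap hL (i := i.rev) (j := ⟨k - 1, by omega⟩)
    (by rw [Fin.le_def, Fin.val_rev]; simp only; omega)
  have h1 := (increasing L ⟨k - 1, by omega⟩).2.2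
  have h2 := part_eq hL i
  simp only [Fin.val_rev] at h
  omega

theorem part_antitone {k n : ℕ} {L : Fin k → Idx k n} (hL : Function.Injective L) :
    Antitone (part L) := by
  intro i j hij
  have h := increasing_gap hL (Fin.rev_le_rev.2 hij)
  have h1 := part_eq hL i
  have h2 := part_eq hL j
  simp only [Fin.val_rev] at h
  omega

/-- The partition (Young diagram) of a tuple of distinct indices: the row lengths are `part L`. -/
def partition {k n : ℕ} (L : Fin k → Idx k n) (hL : Function.Injective L) : YoungDiagram :=
  YoungDiagram.ofRowLens (List.ofFn (part L)) (part_antitone hL).sortedGE_ofFn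

/-- `Λ_{k,n}`: the partitions whose Young diagram fits into the `k × (n - k)` rectangle. -/
abbrev BoxPartition (k n : ℕ) : Type :=
  {μ : YoungDiagram // ∀ c ∈ μ, c.1 < k ∧ c.2 + k < n}

theorem partition_mem_box {k n : ℕ} (L : Fin k → Idx k n) (hL : Function.Injective L) :
    ∀ c ∈ partition L hL, c.1 < k ∧ c.2 + k < n := by
  intro c hc
  obtain ⟨h, h'⟩ := YoungDiagram.mem_ofRowLens.1 hc
  have hk : c.1 < k := by simpa using h
  have h2 := part_le hL ⟨c.1, hk⟩
  simp only [List.getElem_ofFn] at h'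
  exact ⟨hk, by omega⟩

/-- `𝒮_{k,n} = ℂ[π_λ | λ ∈ Λ_{k,n}]`. -/
abbrev FinRing (k n : ℕ) : Type := MvPolynomial (BoxPartition k n) ℂ

/-- The symbol `π̃_L ∈ 𝒮_{k,n}` of an arbitrary `k`-tuple `L`, written through the `π_λ`:
`π̃_L = sgn(L) π_λ`, with `λ` the partition of the increasing rearrangement of `L`, and
`π̃_L = 0` if `L` has repeated indices. -/
def piTilde {k n : ℕ} (L : Fin k → Idx k n) : FinRing k n :=
  open Classical in
  if hL : Function.Injective L then
    (sgn L : FinRing k n) * MvPolynomial.X ⟨partition L hL, partition_mem_box L hL⟩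
  else 0

/-- The Plücker quadratic form
`p_{I,J} = ∑_{j=1}^{k+1} (-1)^j π̃_{I_1,…,I_{k-1},J_j} π̃_{J_1,…,J_{j-1},J_{j+1},…,J_{k+1}}`
in `𝒮_{k,n}`, where `k = m + 1`. -/
def pluckerForm {m n : ℕ} (I : Fin m → Idx (m + 1) n) (J : Fin (m + 2) → Idx (m + 1) n) :
    FinRing (m + 1) n :=
  ∑ j : Fin (m + 2), (-1) ^ ((j : ℕ) + 1) *
    piTilde (Fin.snoc (α := fun _ => Idx (m + 1) n) I (J j)) *
    piTilde (fun i : Fin (m + 1) => J (j.succAbove i))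

/-- The ideal `ℐ_{k,n} ⊆ 𝒮_{k,n}` generated by the Plücker relations. For `k = 0` there are none. -/
def finPluckerIdeal : (k n : ℕ) → Ideal (FinRing k n)
  | 0, _ => ⊥
  | m + 1, n => Ideal.span
      {p | ∃ (I : Fin m → Idx (m + 1) n) (J : Fin (m + 2) → Idx (m + 1) n), p = pluckerForm I J}

/-- `𝒮 = ℂ[π_λ | λ any partition]`, partitions being identified with their Young diagrams. -/
abbrev InfRing : Type := MvPolynomial YoungDiagram ℂ

/-- The inclusion `𝒮_{k,n} → 𝒮`, `π_λ ↦ π_λ`. -/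
def incl (k n : ℕ) : FinRing k n →ₐ[ℂ] InfRing := MvPolynomial.rename Subtype.val

/-- The ideal `ℐ ⊆ 𝒮` generated by all Plücker relations, that is, by the union of the `ℐ_{k,n}`
over `0 ≤ k ≤ n`. -/
def pluckerIdeal : Ideal InfRing :=
  Ideal.span (⋃ (k : ℕ) (n : ℕ) (_ : k ≤ n), incl k n '' (finPluckerIdeal k n : Set (FinRing k n)))

/-- The coordinate ring `𝒮 / ℐ` of the infinite Grassmannian. -/
abbrev CoordRing : Type := InfRing ⧸ pluckerIdeal

end InfGrassmannian

end

noncomputable section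

namespace InfGrassmannian

open Finset

/-! The quotient `𝒮 / ℐ` embeds into a polynomial ring, hence is a domain. The embedding sends `π_μ`
to a scaling variable times a minor of a generic unitriangular matrix (coordinates of the big cell),
where the variable `v + s` steps off the unit diagonal carries `t ^ (v + s) ^ 2` for a parameter
`t`. Minors satisfy the Plücker relations (`plucker_det_relation`), so the map descends to the
quotient. Injectivity is standard monomial theory, a monomial being standard if its partitions form
a chain under inclusion.

Independence: by the rearrangement inequality the diagonal term of each minor is its unique term of
lowest order in `t`, and the product of these diagonal terms determines a chain of partitions.
Images of distinct standard monomials thus have distinct lowest monomials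
(`linearIndependent_standard`).

Spanning: Plücker relations exchange one index of a factor against all indices of the other. In
characteristic zero this forces antisymmetrization over more than `k` positions to vanish
(`antisymmetrize_eq_zero`). Applied at a place where `μ ≤ ν` fails, it rewrites `π_μ π_ν` through
products with a smaller first partition and the same total size (`coordX_mul_coordX_mem_span`). When
`|μ| ≤ |ν|` the sizes spread apart, so straightening terminates.

A combination of standard monomials killed by the map therefore has zero coefficients. -/

theorem le_iff_rowLen_le {μ ν : YoungDiagram} : μ ≤ ν ↔ ∀ r, μ.rowLen r ≤ ν.rowLen r := by
  constructor
  · intro h r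
    by_contra! hlt
    exact lt_irrefl _ (YoungDiagram.mem_iff_lt_rowLen.1 (h (YoungDiagram.mem_iff_lt_rowLen.2 hlt)))
  · rintro h ⟨r, s⟩ hc
    exact YoungDiagram.mem_iff_lt_rowLen.2 ((YoungDiagram.mem_iff_lt_rowLen.1 hc).trans_le (h r))

theorem eq_of_rowLen_eq {μ ν : YoungDiagram} (h : ∀ r, μ.rowLen r = ν.rowLen r) : μ = ν :=
  le_antisymm (le_iff_rowLen_le.2 fun r => (h r).le) (le_iff_rowLen_le.2 fun r => (h r).ge)

theorem rowLen_pos_iff {μ : YoungDiagram} {r : ℕ} : 0 < μ.rowLen r ↔ r < μ.colLen 0 :=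
  YoungDiagram.mem_iff_lt_rowLen.symm.trans YoungDiagram.mem_iff_lt_colLen

theorem rowLen_eq_zero_iff {μ : YoungDiagram} {r : ℕ} : μ.rowLen r = 0 ↔ μ.colLen 0 ≤ r := by
  rw [← not_lt, ← rowLen_pos_iff]; omega

/-! ### Parametrization by the big cell -/

/-- The domain in which the coordinate ring of the infinite Grassmannian is embedded: polynomials
in coordinates of the big cell, a scaling variable and a degeneration parameter. -/
abbrev CellRing : Type := Polynomial (MvPolynomial (ℕ × ℕ) ℂ)

/-- The entries of the unitriangular matrix of cell coordinates. -/
def cellEntry (v : ℤ) (s : ℕ) : CellRing :=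
  if v + s < 0 then 0 else if v + s = 0 then 1 else
    Polynomial.X ^ (v + s).toNat ^ 2 * Polynomial.C (MvPolynomial.X ((v + s).toNat, s))

/-- The minor of the matrix of cell coordinates belonging to a partition with at most `k` parts. -/
def cellMinor (k : ℕ) (μ : YoungDiagram) : CellRing :=
  Matrix.det (Matrix.of fun r s : Fin k => cellEntry ((μ.rowLen r : ℤ) - (r : ℕ)) s)

/-- The variable homogenizing the minors. -/
def scale : CellRing := Polynomial.C (MvPolynomial.X (0, 0))

/-- The parametrization of the cone over the infinite Grassmannian by the big cell. -/
def cellMap : InfRing →ₐ[ℂ] CellRing :=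
  MvPolynomial.aeval fun μ => scale * cellMinor (μ.colLen 0) μ

theorem det_eq_det_submatrix_castSucc {R : Type*} [CommRing R] {k : ℕ}
    (A : Matrix (Fin (k + 1)) (Fin (k + 1)) R) (h0 : ∀ j : Fin k, A (Fin.last k) j.castSucc = 0)
    (h1 : A (Fin.last k) (Fin.last k) = 1) :
    A.det = (A.submatrix Fin.castSucc Fin.castSucc).det := by
  rw [Matrix.det_succ_row _ (Fin.last k), Fin.sum_univ_castSucc, Finset.sum_eq_zero, zero_add]
  · simp [h1, ← two_mul]
  · intro j _
    simp [h0]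

/-- An empty row `k` contributes the last row `(0, …, 0, 1)`. Hence the size of the minor is
immaterial once it covers all parts, and different partitions can share one `k`. -/
theorem cellMinor_succ {k : ℕ} {μ : YoungDiagram} (h : μ.rowLen k = 0) :
    cellMinor (k + 1) μ = cellMinor k μ := by
  rw [cellMinor, det_eq_det_submatrix_castSucc]
  · rfl
  · intro j
    rw [Matrix.of_apply, cellEntry, if_pos]
    simp [h]
  · rw [Matrix.of_apply, cellEntry, if_neg, if_pos] <;> simp [h]

theorem cellMinor_of_le {k : ℕ} {μ : YoungDiagram} (h : μ.colLen 0 ≤ k) :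
    cellMinor k μ = cellMinor (μ.colLen 0) μ := by
  induction k, h using Nat.le_induction with
  | base => rfl
  | succ k hk ih => rw [cellMinor_succ (rowLen_eq_zero_iff.2 hk), ih]

theorem cellMap_X {k : ℕ} {μ : YoungDiagram} (h : μ.colLen 0 ≤ k) :
    cellMap (MvPolynomial.X μ) = scale * cellMinor k μ := by
  rw [cellMap, MvPolynomial.aeval_X, cellMinor_of_le h]

/-! ### Lowest terms in the degeneration parameter -/

/-- `f` has order `w` in the degeneration parameter, with the monomial of exponent `e` as its lowest
coefficient. -/
def HasLowestTerm (f : CellRing) (w : ℕ) (e : ℕ × ℕ →₀ ℕ) : Prop :=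
  ∃ g, f = Polynomial.X ^ w * Polynomial.C (MvPolynomial.monomial e 1) + Polynomial.X ^ (w + 1) * g

theorem HasLowestTerm.one : HasLowestTerm 1 0 0 := ⟨0, by simp⟩

theorem HasLowestTerm.mul {f g : CellRing} {v w : ℕ} {d e : ℕ × ℕ →₀ ℕ} (hf : HasLowestTerm f v d)
    (hg : HasLowestTerm g w e) : HasLowestTerm (f * g) (v + w) (d + e) := by
  obtain ⟨a, rfl⟩ := hf
  obtain ⟨b, rfl⟩ := hg
  have h : MvPolynomial.monomial (d + e) (1 : ℂ) =
      MvPolynomial.monomial d 1 * MvPolynomial.monomial e 1 := by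
    rw [MvPolynomial.monomial_mul, one_mul]
  rw [HasLowestTerm, h, Polynomial.C_mul]
  exact ⟨Polynomial.C (MvPolynomial.monomial d 1) * b + Polynomial.C (MvPolynomial.monomial e 1) * a
    + Polynomial.X * a * b, by ring⟩

theorem HasLowestTerm.multiset_prod {ι : Type*} {f : ι → CellRing} {w : ι → ℕ}
    {e : ι → (ℕ × ℕ →₀ ℕ)} (h : ∀ i, HasLowestTerm (f i) (w i) (e i)) (m : Multiset ι) :
    HasLowestTerm (m.map f).prod (m.map w).sum (m.map e).sum := by
  induction m using Multiset.induction_on with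
  | empty => simpa using HasLowestTerm.one
  | cons a m ih => simpa using (h a).mul ih

theorem HasLowestTerm.coeff_of_lt {f : CellRing} {v w : ℕ} {e : ℕ × ℕ →₀ ℕ}
    (hf : HasLowestTerm f w e) (h : v < w) : f.coeff v = 0 := by
  obtain ⟨g, rfl⟩ := hf
  rw [Polynomial.coeff_add, Polynomial.coeff_X_pow_mul', Polynomial.coeff_X_pow_mul',
    if_neg (by omega), if_neg (by omega), add_zero]

theorem HasLowestTerm.coeff_self {f : CellRing} {w : ℕ} {e : ℕ × ℕ →₀ ℕ}
    (hf : HasLowestTerm f w e) : f.coeff w = MvPolynomial.monomial e 1 := by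
  obtain ⟨g, rfl⟩ := hf
  rw [Polynomial.coeff_add, Polynomial.coeff_X_pow_mul', Polynomial.coeff_X_pow_mul',
    if_pos le_rfl, if_neg (by omega), add_zero, Nat.sub_self, Polynomial.coeff_C_zero]

/-- In a nontrivial relation pick a term `i` of least order. At order `w i` and monomial `e i` no
other term contributes, so its coefficient vanishes. -/
theorem linearIndependent_of_hasLowestTerm {ι : Type*} {f : ι → CellRing} {w : ι → ℕ}
    {e : ι → (ℕ × ℕ →₀ ℕ)} (h : ∀ i, HasLowestTerm (f i) (w i) (e i))
    (he : Function.Injective e) : LinearIndependent ℂ f := by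
  classical
  rw [linearIndependent_iff]
  intro l hl
  by_contra hne
  obtain ⟨i, hi, hmin⟩ := Finset.exists_min_image l.support w (Finsupp.support_nonempty_iff.2 hne)
  have h1 := congrArg (fun p : CellRing => MvPolynomial.coeff (e i) (p.coeff (w i))) hl
  simp only [Finsupp.linearCombination_apply, Finsupp.sum, Polynomial.finsetSum_coeff,
    Polynomial.coeff_smul, MvPolynomial.coeff_sum, MvPolynomial.coeff_smul, Polynomial.coeff_zero,
    MvPolynomial.coeff_zero] at h1
  rw [Finset.sum_eq_single i] at h1
  · rw [(h i).coeff_self, MvPolynomial.coeff_monomial, if_pos rfl, smul_eq_mul, mul_one] at h1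
    exact Finsupp.mem_support_iff.1 hi h1
  · intro j hj hji
    rcases (hmin j hj).lt_or_eq with hlt | heq
    · rw [(h j).coeff_of_lt hlt, MvPolynomial.coeff_zero, smul_zero]
    · rw [heq, (h j).coeff_self, MvPolynomial.coeff_monomial, if_neg fun h2 => hji (he h2),
        smul_zero]
  · intro h2
    exact absurd hi h2

theorem X_pow_dvd_cellEntry (v : ℤ) (s : ℕ) :
    Polynomial.X ^ (v + s).toNat ^ 2 ∣ cellEntry v s := by
  unfold cellEntry
  split_ifs with h1 h2
  · exact dvd_zero _
  · simp [h2]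
  · exact dvd_mul_right _ _

/-- After expanding the squares only the cross term `∑ v (σ i) * i` depends on `σ`, and the
rearrangement inequality applies. Equality would make `σ` monotone, hence the identity. -/
theorem sum_sq_lt_sum_sq_comp_perm {k : ℕ} {v : Fin k → ℤ} (hv : StrictAnti v)
    {σ : Equiv.Perm (Fin k)} (hσ : σ ≠ 1) :
    ∑ i, (v i + (i : ℕ)) ^ 2 < ∑ i, (v (σ i) + (i : ℕ)) ^ 2 := by
  have hg : StrictMono fun i : Fin k => ((i : ℕ) : ℤ) := fun i j h => by simpa using h
  have h := (hv.antitone.antivary hg.monotone).sum_mul_lt_sum_comp_perm_mul_iff (σ := σ)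
  have h1 : ¬ Antivary (v ∘ σ) fun i : Fin k => ((i : ℕ) : ℤ) := by
    intro h2
    apply hσ
    have h3 : StrictMono σ := by
      refine Monotone.strictMono_of_injective (fun i j hij => ?_) σ.injective
      rcases hij.eq_or_lt with rfl | hij
      · exact le_rfl
      · exact hv.le_iff_ge.1 (h2 (hg hij))
    ext i
    have := Subsingleton.elim (StrictMono.orderIsoOfSurjective σ h3 σ.surjective)
      (OrderIso.refl (Fin k))
    exact congrArg Fin.val (congrArg (fun f : Fin k ≃o Fin k => f i) this)
  have h2 := h.2 h1
  have h3 := Equiv.sum_comp σ fun i => v i ^ 2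
  simp only [add_sq, sum_add_distrib]
  simp only [mul_assoc, ← mul_sum]
  linarith

/-- The total degree in the degeneration parameter of the diagonal term of the minor. -/
def rowWeight (μ : YoungDiagram) : ℕ := ∑ r : Fin (μ.colLen 0), μ.rowLen r ^ 2

/-- The exponent of the diagonal term of the scaled minor. -/
def rowExponent (μ : YoungDiagram) : ℕ × ℕ →₀ ℕ :=
  Finsupp.single (0, 0) 1 + ∑ r : Fin (μ.colLen 0), Finsupp.single (μ.rowLen r, (r : ℕ)) 1

/-- The squared exponents in `cellEntry` serve this purpose: every nonzero term of the determinant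
other than the diagonal one has strictly larger order in `t`. -/
theorem hasLowestTerm_cellMap_X (μ : YoungDiagram) :
    HasLowestTerm (cellMap (MvPolynomial.X μ)) (rowWeight μ) (rowExponent μ) := by
  have hs : HasLowestTerm scale 0 (Finsupp.single (0, 0) 1) := ⟨0, by simp [scale, MvPolynomial.X]⟩
  rw [cellMap_X le_rfl, ← zero_add (rowWeight μ)]
  refine hs.mul ?_
  set v : Fin (μ.colLen 0) → ℤ := fun r => (μ.rowLen r : ℤ) - (r : ℕ) with hv
  have hanti : StrictAnti v := by
    intro i j hij
    have h1 := μ.rowLen_anti i j hij.le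
    have h2 : (i : ℕ) < j := hij
    simp only [hv]
    omega
  have hone : ∏ i, cellEntry (v i) i = Polynomial.X ^ rowWeight μ * Polynomial.C
      (MvPolynomial.monomial (∑ r : Fin (μ.colLen 0), Finsupp.single (μ.rowLen r, (r : ℕ)) 1) 1) := by
    rw [rowWeight, MvPolynomial.monomial_sum_one, map_prod, ← Finset.prod_pow_eq_pow_sum,
      ← Finset.prod_mul_distrib]
    refine Finset.prod_congr rfl fun i _ => ?_
    have hpos := rowLen_pos_iff.2 i.2
    have h1 : v i + (i : ℕ) = μ.rowLen i := by simp [hv]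
    rw [cellEntry, h1, if_neg (by omega), if_neg (by omega), Int.toNat_natCast, MvPolynomial.X]
  rw [cellMinor, Matrix.det_apply, ← Finset.add_sum_erase _ _ (Finset.mem_univ 1)]
  have hdvd : Polynomial.X ^ (rowWeight μ + 1) ∣ ∑ σ ∈ Finset.univ.erase 1,
      Equiv.Perm.sign σ • ∏ i, (Matrix.of fun r s : Fin (μ.colLen 0) =>
        cellEntry ((μ.rowLen r : ℤ) - (r : ℕ)) s) (σ i) i := by
    refine Finset.dvd_sum fun σ hσ => ?_
    rw [Units.smul_def, zsmul_eq_mul]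
    refine Dvd.dvd.mul_left ?_ _
    change _ ∣ ∏ i, cellEntry (v (σ i)) i
    -- A negative argument makes an entry, hence the whole term, zero; otherwise `toNat` loses
    -- nothing and the sums of squares can be compared over `ℤ`.
    by_cases hneg : ∃ i, v (σ i) + (i : ℕ) < 0
    · obtain ⟨i, hi⟩ := hneg
      rw [Finset.prod_eq_zero (Finset.mem_univ i)]
      · exact dvd_zero _
      · rw [cellEntry, if_pos hi]
    · push Not at hneg
      refine (pow_dvd_pow _ ?_).trans
        ((Finset.prod_pow_eq_pow_sum Finset.univ (fun i => (v (σ i) + (i : ℕ)).toNat ^ 2)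
          (Polynomial.X : CellRing)).symm.dvd.trans
          (Finset.prod_dvd_prod_of_dvd _ _ fun i _ => X_pow_dvd_cellEntry _ _))
      have h := sum_sq_lt_sum_sq_comp_perm hanti (Finset.ne_of_mem_erase hσ)
      zify
      have h1 : ∀ i, (((v (σ i) + (i : ℕ)).toNat : ℕ) : ℤ) = v (σ i) + (i : ℕ) := fun i =>
        Int.toNat_of_nonneg (hneg i)
      have h2 : (rowWeight μ : ℤ) = ∑ i, (v i + (i : ℕ)) ^ 2 := by
        simp [rowWeight, hv]
      simp only [h1, h2]
      omega
  obtain ⟨g, hg⟩ := hdvd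
  refine ⟨g, ?_⟩
  rw [hg, ← hone]
  simp [hv]

/-! ### Standard monomials and their independence -/

/-- A multiset of partitions is standard if its members are pairwise comparable. -/
def IsStandard (m : Multiset YoungDiagram) : Prop := ∀ μ ∈ m, ∀ ν ∈ m, μ ≤ ν ∨ ν ≤ μ

theorem rowExponent_ne_zero_iff {μ : YoungDiagram} {p r : ℕ} (hp : 0 < p) :
    rowExponent μ (p, r) ≠ 0 ↔ μ.rowLen r = p := by
  classical
  have h0 : ((0 : ℕ), (0 : ℕ)) ≠ (p, r) := by simp [hp.ne]
  simp only [rowExponent, Finsupp.add_apply, Finsupp.finsetSum_apply, Finsupp.single_apply, h0,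
    if_false, zero_add, ne_eq, Finset.sum_eq_zero_iff, Finset.mem_univ, true_imp_iff, not_forall]
  constructor
  · rintro ⟨i, hi⟩
    have : (μ.rowLen i, (i : ℕ)) = (p, r) := by by_contra h; simp [h] at hi
    simp only [Prod.mk.injEq] at this
    rw [← this.2, this.1]
  · rintro rfl
    exact ⟨⟨r, rowLen_pos_iff.1 hp⟩, by simp⟩

theorem rowExponent_zero_ne_zero (μ : YoungDiagram) : rowExponent μ (0, 0) ≠ 0 := by
  simp [rowExponent]

theorem multiset_sum_map_apply_ne_zero_iff {ι α : Type*} (f : ι → (α →₀ ℕ)) (m : Multiset ι)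
    (x : α) : (m.map f).sum x ≠ 0 ↔ ∃ i ∈ m, f i x ≠ 0 := by
  induction m using Multiset.induction_on with
  | empty => simp
  | cons a m ih =>
    rw [Multiset.map_cons, Multiset.sum_cons, Finsupp.add_apply]
    simp only [Multiset.mem_cons, exists_eq_or_imp, ← ih]
    omega

theorem IsStandard.exists_top {m : Multiset YoungDiagram} (hm : IsStandard m) (h0 : m ≠ 0) :
    ∃ μ ∈ m, ∀ ν ∈ m, ν ≤ μ := by
  classical
  obtain ⟨μ, hμ⟩ := m.toFinset.exists_maximal
    (by simpa [Finset.nonempty_iff_ne_empty, Multiset.toFinset_eq_empty] using h0)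
  refine ⟨μ, by simpa using hμ.1, fun ν hν => ?_⟩
  rcases hm μ (by simpa using hμ.1) ν hν with h | h
  · exact hμ.2 (by simpa using hν) h
  · exact h

theorem IsStandard.of_le {m m' : Multiset YoungDiagram} (hm : IsStandard m) (h : m' ≤ m) :
    IsStandard m' := fun μ hμ ν hν =>
  hm μ (Multiset.mem_of_le h hμ) ν (Multiset.mem_of_le h hν)

/-- For `p > 0` the variable `(p, r)` occurs exactly when some member has row `r` of length `p`. So
each nonzero row of `μ` is also a row of some member of `m'`. -/
theorem top_le_of_rowExponent_eq {m m' : Multiset YoungDiagram}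
    (h : (m.map rowExponent).sum = (m'.map rowExponent).sum) {μ μ' : YoungDiagram} (hμ : μ ∈ m)
    (hμ' : ∀ ν ∈ m', ν ≤ μ') : μ ≤ μ' := by
  rw [le_iff_rowLen_le]
  intro r
  rcases Nat.eq_zero_or_pos (μ.rowLen r) with h0 | hp
  · rw [h0]; exact Nat.zero_le _
  · have h1 := (multiset_sum_map_apply_ne_zero_iff rowExponent m (μ.rowLen r, r)).2
      ⟨μ, hμ, (rowExponent_ne_zero_iff hp).2 rfl⟩
    rw [h, multiset_sum_map_apply_ne_zero_iff] at h1
    obtain ⟨ν, hν, h2⟩ := h1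
    rw [← (rowExponent_ne_zero_iff hp).1 h2]
    exact le_iff_rowLen_le.1 (hμ' ν hν) r

theorem eq_zero_of_rowExponent_eq_zero {m : Multiset YoungDiagram}
    (h : (m.map rowExponent).sum = 0) : m = 0 := by
  by_contra h0
  obtain ⟨μ, hμ⟩ := Multiset.exists_mem_of_ne_zero h0
  exact (multiset_sum_map_apply_ne_zero_iff rowExponent m (0, 0)).2
    ⟨μ, hμ, rowExponent_zero_ne_zero μ⟩ (by rw [h]; rfl)

/-- The greatest members agree, so they can be cancelled inductively. The scaling variable `(0, 0)`
detects whether a multiset is empty; without it the empty partition would be invisible. -/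
theorem IsStandard.eq_of_rowExponent_eq {m m' : Multiset YoungDiagram} (hm : IsStandard m)
    (hm' : IsStandard m') (h : (m.map rowExponent).sum = (m'.map rowExponent).sum) : m = m' := by
  induction hn : Multiset.card m generalizing m m' with
  | zero =>
    obtain rfl := Multiset.card_eq_zero.1 hn
    exact (eq_zero_of_rowExponent_eq_zero h.symm).symm
  | succ n ih =>
    have h0 : m ≠ 0 := by rintro rfl; simp at hn
    have h0' : m' ≠ 0 := by
      rintro rfl
      exact h0 (eq_zero_of_rowExponent_eq_zero h)
    obtain ⟨μ, hμ, hle⟩ := hm.exists_top h0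
    obtain ⟨μ', hμ', hle'⟩ := hm'.exists_top h0'
    obtain rfl : μ = μ' := le_antisymm (top_le_of_rowExponent_eq h hμ hle')
      (top_le_of_rowExponent_eq h.symm hμ' hle)
    obtain ⟨t, rfl⟩ := Multiset.exists_cons_of_mem hμ
    obtain ⟨t', rfl⟩ := Multiset.exists_cons_of_mem hμ'
    rw [ih (hm.of_le (Multiset.le_cons_self t μ)) (hm'.of_le (Multiset.le_cons_self t' μ))
      (by simpa using h) (by simpa using hn)]

theorem linearIndependent_standard : LinearIndependent ℂ
    fun m : {m : Multiset YoungDiagram // IsStandard m} =>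
      cellMap (m.1.map MvPolynomial.X).prod := by
  refine linearIndependent_of_hasLowestTerm (w := fun m => (m.1.map rowWeight).sum)
    (e := fun m => (m.1.map rowExponent).sum) (fun m => ?_)
    fun m m' h => Subtype.ext (m.2.eq_of_rowExponent_eq m'.2 h)
  rw [map_multiset_prod, Multiset.map_map]
  exact HasLowestTerm.multiset_prod hasLowestTerm_cellMap_X m.1

/-! ### Plücker relations for the minors -/

/-- Expanding the first determinant along its last row `b (J j)` turns the sum over `j`, for each
column `s`, into the expansion of a determinant of size `m + 2` whose column `s` is repeated. -/
theorem plucker_det_relation {R X : Type*} [CommRing R] {m : ℕ} (b : X → Fin (m + 1) → R)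
    (I : Fin m → X) (J : Fin (m + 2) → X) :
    ∑ j : Fin (m + 2), (-1) ^ ((j : ℕ) + 1) *
      Matrix.det (Matrix.of fun i => b (Fin.snoc (α := fun _ => X) I (J j) i)) *
      Matrix.det (Matrix.of fun i => b (J (j.succAbove i))) = 0 := by
  have hcol : ∀ s : Fin (m + 1), ∑ j : Fin (m + 2), (-1) ^ (j : ℕ) * b (J j) s *
      Matrix.det (Matrix.of fun i => b (J (j.succAbove i))) = 0 := by
    intro s
    have h := Matrix.det_succ_column_zero
      (Matrix.of fun j => Fin.cons (α := fun _ => R) (b (J j) s) (b (J j)))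
    rw [Matrix.det_zero_of_column_eq (Fin.succ_ne_zero s).symm (by simp)] at h
    rw [h]
    rfl
  have hrow : ∀ x : X, Matrix.det (Matrix.of fun i => b (Fin.snoc (α := fun _ => X) I x i)) =
      ∑ s : Fin (m + 1), (-1) ^ (m + s : ℕ) * b x s *
        Matrix.det (Matrix.of fun i t => b (I i) (s.succAbove t)) := by
    intro x
    rw [Matrix.det_succ_row _ (Fin.last m)]
    refine Finset.sum_congr rfl fun s _ => ?_
    simp only [Matrix.of_apply, Fin.snoc_last, Fin.val_last]
    congr 2
    ext i t
    simp
  simp only [hrow, Finset.mul_sum, Finset.sum_mul]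
  rw [Finset.sum_comm]
  refine Finset.sum_eq_zero fun s _ => ?_
  rw [← mul_zero (-(-1) ^ (m + s : ℕ) *
    Matrix.det (Matrix.of fun i t => b (I i) (s.succAbove t))), ← hcol s, Finset.mul_sum]
  refine Finset.sum_congr rfl fun j _ => ?_
  ring

theorem colLen_partition_le {k n : ℕ} {L : Fin k → Idx k n} (hL : Function.Injective L) :
    (partition L hL).colLen 0 ≤ k := by
  by_contra! h
  exact lt_irrefl _ (partition_mem_box L hL _ (YoungDiagram.mem_iff_lt_colLen.2 h)).1

theorem rowLen_partition {k n : ℕ} {L : Fin k → Idx k n} (hL : Function.Injective L) (r : Fin k) :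
    (partition L hL).rowLen r = part L r := by
  have h := YoungDiagram.rowLen_ofRowLens (w := List.ofFn (part L))
    (hw := (part_antitone hL).sortedGE_ofFn) (r.cast (by simp))
  rw [partition]
  simpa using h

theorem incl_piTilde {k n : ℕ} {L : Fin k → Idx k n} (hL : Function.Injective L) :
    incl k n (piTilde L) = ((Equiv.Perm.sign (Tuple.sort L) : ℤˣ) : InfRing) *
      MvPolynomial.X (partition L hL) := by
  simp [piTilde, hL, incl, sgn]

theorem piTilde_of_not_injective {k n : ℕ} {L : Fin k → Idx k n} (hL : ¬ Function.Injective L) :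
    piTilde L = 0 := by
  simp [piTilde, hL]

/-- Since `λ_r - r` is the index in position `r.rev` of the sorted tuple plus one, sorting the rows
and reversing rows and columns gives the cell minor; the sorting sign cancels the one in `piTilde`.
-/
theorem cellMap_incl_piTilde {k n : ℕ} (L : Fin k → Idx k n) :
    cellMap (incl k n (piTilde L)) = scale *
      Matrix.det (Matrix.of fun i (s : Fin k) => cellEntry ((L i : ℤ) + 1) s.rev) := by
  by_cases hL : Function.Injective L
  · set M : Matrix (Fin k) (Fin k) CellRing :=
      Matrix.of fun i (s : Fin k) => cellEntry ((L i : ℤ) + 1) s.rev with hM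
    have h1 : cellMinor k (partition L hL) = Equiv.Perm.sign (Tuple.sort L) * M.det := by
      rw [← Matrix.det_permute, ← Matrix.det_submatrix_equiv_self Fin.revPerm, cellMinor]
      congr 1
      ext1 r s
      rw [Matrix.of_apply, rowLen_partition, part_eq hL]
      simp only [hM, Matrix.submatrix_apply, Matrix.of_apply, Fin.revPerm_apply, id, Fin.rev_rev,
        increasing, Function.comp]
      congr 1
      ring
    have h2 : (((Equiv.Perm.sign (Tuple.sort L) : ℤˣ) : ℤ) : CellRing) *
        ((Equiv.Perm.sign (Tuple.sort L) : ℤˣ) : ℤ) = 1 := by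
      rw [← Int.cast_mul, ← Units.val_mul, Int.units_mul_self, Units.val_one, Int.cast_one]
    rw [incl_piTilde hL, map_mul, map_intCast, cellMap_X (colLen_partition_le hL), h1]
    linear_combination scale * M.det * h2
  · rw [piTilde_of_not_injective hL, map_zero, map_zero]
    simp only [Function.Injective, not_forall] at hL
    obtain ⟨i, j, hij, hne⟩ := hL
    rw [Matrix.det_zero_of_row_eq hne, mul_zero]
    ext1 s
    simp [hij]

theorem cellMap_incl_pluckerForm {m n : ℕ} (I : Fin m → Idx (m + 1) n)
    (J : Fin (m + 2) → Idx (m + 1) n) : cellMap (incl (m + 1) n (pluckerForm I J)) = 0 := by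
  have h := plucker_det_relation
    (fun (ℓ : Idx (m + 1) n) (s : Fin (m + 1)) => cellEntry ((ℓ : ℤ) + 1) s.rev) I J
  rw [← mul_zero (scale * scale), ← h, pluckerForm, map_sum, map_sum, Finset.mul_sum]
  refine Finset.sum_congr rfl fun j _ => ?_
  simp only [map_mul, map_pow, map_neg, map_one, cellMap_incl_piTilde]
  ring

theorem pluckerIdeal_le_ker : pluckerIdeal ≤ RingHom.ker cellMap := by
  refine Ideal.span_le.2 (Set.iUnion_subset fun k => Set.iUnion_subset fun n =>
    Set.iUnion_subset fun _ => ?_)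
  rw [Set.image_subset_iff]
  cases k with
  | zero =>
    intro p hp
    obtain rfl : p = 0 := by simpa [finPluckerIdeal] using hp
    simp
  | succ m =>
    have h : finPluckerIdeal (m + 1) n ≤
        (RingHom.ker cellMap).comap (incl (m + 1) n : FinRing (m + 1) n →ₐ[ℂ] InfRing) := by
      refine Ideal.span_le.2 ?_
      rintro _ ⟨I, J, rfl⟩
      exact cellMap_incl_pluckerForm I J
    exact h

theorem incl_pluckerForm_mem {m n : ℕ} (h : m + 1 ≤ n) (I : Fin m → Idx (m + 1) n)
    (J : Fin (m + 2) → Idx (m + 1) n) : incl (m + 1) n (pluckerForm I J) ∈ pluckerIdeal :=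
  Ideal.subset_span (Set.mem_iUnion₂.2 ⟨m + 1, n, Set.mem_iUnion.2
    ⟨h, Set.mem_image_of_mem _ (Ideal.subset_span ⟨I, J, rfl⟩)⟩⟩)

theorem piTilde_comp_perm {k n : ℕ} (L : Fin k → Idx k n) (σ : Equiv.Perm (Fin k)) :
    piTilde (L ∘ σ) = ((Equiv.Perm.sign σ : ℤˣ) : ℤ) * piTilde L := by
  by_cases hL : Function.Injective L
  · have hLσ : Function.Injective (L ∘ σ) := hL.comp σ.injective
    have hinc : increasing (L ∘ σ) = increasing L := Tuple.comp_perm_comp_sort_eq_comp_sort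
    have hsort : σ * Tuple.sort (L ∘ σ) = Tuple.sort L :=
      Equiv.ext fun i => hL (congrFun hinc i)
    have hpart : partition (L ∘ σ) hLσ = partition L hL := by
      have hp : part (L ∘ σ) = part L := by
        funext i
        simp only [part, hinc]
      simp only [partition, hp]
    have hsgn : sgn (L ∘ σ) = Equiv.Perm.sign σ * sgn L := by
      rw [sgn, sgn, if_pos hL, if_pos hLσ, ← hsort, Equiv.Perm.sign_mul, Units.val_mul, ← mul_assoc,
        ← Units.val_mul, Int.units_mul_self, Units.val_one, one_mul]
    simp only [piTilde, hL, hLσ, dif_pos, hpart, hsgn]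
    push_cast
    ring
  · have hLσ : ¬ Function.Injective (L ∘ σ) := by
      rwa [Equiv.injective_comp]
    rw [piTilde_of_not_injective hL, piTilde_of_not_injective hLσ, mul_zero]

/-! ### Antisymmetrization and exchange relations -/

section Exchange

variable {α β X A : Type*} [Fintype α] [Fintype β] [DecidableEq α] [DecidableEq β] [AddCommGroup A]

/-- The antisymmetrization of `F` over the positions in `P`. -/
def antisymmetrize (F : (α ⊕ β → X) → A) (P : Finset (α ⊕ β)) (w : α ⊕ β → X) : A :=
  ∑ τ : Equiv.Perm (α ⊕ β) with ∀ x, x ∉ P → τ x = x, (Equiv.Perm.sign τ : ℤˣ) • F (w ∘ τ)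

theorem antisymmetrize_swap_of_mem (F : (α ⊕ β → X) → A) {P : Finset (α ⊕ β)} (w : α ⊕ β → X)
    {x y : α ⊕ β} (hxy : x ≠ y) (hx : x ∈ P) (hy : y ∈ P) :
    ∑ τ : Equiv.Perm (α ⊕ β) with ∀ z, z ∉ P → τ z = z,
      (Equiv.Perm.sign τ : ℤˣ) • F (w ∘ τ ∘ Equiv.swap x y) = -antisymmetrize F P w := by
  rw [antisymmetrize, ← Finset.sum_neg_distrib]
  refine Finset.sum_equiv (Equiv.mulRight (Equiv.swap x y)) (fun τ => ?_) fun τ _ => ?_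
  · simp only [Finset.mem_filter, Finset.mem_univ, true_and, Equiv.coe_mulRight, Equiv.Perm.mul_apply]
    refine forall₂_congr fun z hz => ?_
    rw [Equiv.swap_apply_of_ne_of_ne (by rintro rfl; exact hz hx) (by rintro rfl; exact hz hy)]
  · simp only [Equiv.coe_mulRight, Equiv.Perm.sign_mul, Equiv.Perm.sign_swap hxy, mul_neg, mul_one,
      Units.neg_smul, neg_neg, Equiv.Perm.coe_mul]

/-- Conjugation by the transposition preserves signs and carries permutations supported on `P` to
those supported on its image. -/
theorem antisymmetrize_swap (F : (α ⊕ β → X) → A) (P : Finset (α ⊕ β)) (w : α ⊕ β → X)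
    (x y : α ⊕ β) :
    ∑ τ : Equiv.Perm (α ⊕ β) with ∀ z, z ∉ P → τ z = z,
      (Equiv.Perm.sign τ : ℤˣ) • F (w ∘ τ ∘ Equiv.swap x y) =
    antisymmetrize F (P.map (Equiv.swap x y).toEmbedding) (w ∘ Equiv.swap x y) := by
  rw [antisymmetrize]
  set s := Equiv.swap x y with hs
  have hss : ∀ z, s (s z) = z := Equiv.swap_apply_self x y
  refine Finset.sum_equiv (MulAut.conj s).toEquiv (fun τ => ?_) fun τ _ => ?_
  · simp only [Finset.mem_filter, Finset.mem_univ, true_and, Finset.mem_map_equiv,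
      MulEquiv.toEquiv_eq_coe, EquivLike.coe_coe, MulAut.conj_apply, Equiv.Perm.mul_apply]
    have hsymm : s.symm = s := Equiv.symm_swap x y
    have hinv : s⁻¹ = s := hsymm
    rw [hsymm, hinv]
    constructor
    · intro h z hz
      rw [h _ hz, hss]
    · intro h z hz
      have := h (s z) (by rwa [hss])
      rw [hss] at this
      exact s.injective this
  · have hinv : s⁻¹ = s := Equiv.symm_swap x y
    simp only [MulEquiv.toEquiv_eq_coe, EquivLike.coe_coe, MulAut.conj_apply,
      Equiv.Perm.sign_mul, hinv]
    congr 1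
    · rw [mul_comm, ← mul_assoc, Int.units_mul_self, one_mul]
    · congr 1
      ext1 z
      simp [hss]

/-- A function satisfying the exchange relations of a single position on the left with all positions
on the right vanishes after antisymmetrization over more positions than there are on the right. -/
theorem antisymmetrize_eq_zero (K : Type*) [Field K] [CharZero K] [Module K A]
    {F : (α ⊕ β → X) → A}
    (hF : ∀ w i, F w = ∑ j, F (w ∘ Equiv.swap (Sum.inl i) (Sum.inr j)))
    {P : Finset (α ⊕ β)} (hP : Fintype.card β < P.card) (w : α ⊕ β → X) :
    antisymmetrize F P w = 0 := by
  induction hn : P.toLeft.card using Nat.strong_induction_on generalizing P w with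
  | _ n ih =>
  have hpos : 0 < P.toLeft.card := by
    have h1 := P.card_toLeft_add_card_toRight
    have h2 := P.toRight.card_le_univ
    omega
  obtain ⟨i, hi⟩ := Finset.card_pos.1 hpos
  rw [Finset.mem_toLeft] at hi
  -- Exchange at `i`: a partner `j` in `P` only flips the sign. A partner outside `P` replaces `i`
  -- in the position set, leaving fewer left positions, so that sum vanishes by induction.
  have key : antisymmetrize F P w =
      ∑ j : β, if Sum.inr j ∈ P then -antisymmetrize F P w else 0 := by
    conv_lhs => rw [antisymmetrize]
    rw [Finset.sum_congr rfl fun τ _ => by rw [hF (w ∘ τ) i, Finset.smul_sum], Finset.sum_comm]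
    refine Finset.sum_congr rfl fun j _ => ?_
    split_ifs with hj
    · exact antisymmetrize_swap_of_mem F w (by simp) hi hj
    · refine (antisymmetrize_swap F P w _ _).trans (ih _ ?_ ?_ _ rfl)
      · rw [← hn]
        refine Finset.card_lt_card ⟨fun a ha => ?_, fun h => ?_⟩
        · rw [Finset.mem_toLeft, Finset.mem_map_equiv, Equiv.symm_swap] at ha
          rw [Finset.mem_toLeft]
          by_cases hai : a = i
          · rw [hai]; exact hi
          · rwa [Equiv.swap_apply_of_ne_of_ne (by simpa using hai) (by simp)] at ha
        · have := h (Finset.mem_toLeft.2 hi)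
          rw [Finset.mem_toLeft, Finset.mem_map_equiv, Equiv.symm_swap,
            Equiv.swap_apply_left] at this
          exact hj this
      · rwa [Finset.card_map]
  -- With `q` right positions in `P`, the antisymmetrization equals `-q` times itself, and `q + 1`
  -- is invertible.
  rw [← Finset.sum_filter, Finset.sum_const, smul_neg, eq_neg_iff_add_eq_zero] at key
  have h : (((Finset.univ.filter fun j : β => Sum.inr j ∈ P).card + 1 : ℕ) : K) •
      antisymmetrize F P w = 0 := by
    rw [Nat.cast_smul_eq_nsmul, succ_nsmul, add_comm, key]
  exact (smul_eq_zero.1 h).resolve_left (Nat.cast_ne_zero.2 (Nat.succ_ne_zero _))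

end Exchange

/-! ### Exchange relations in the coordinate ring -/

/-- The class of `π̃_L` in the coordinate ring. -/
def coord {k n : ℕ} (L : Fin k → Idx k n) : CoordRing :=
  Ideal.Quotient.mk pluckerIdeal (incl k n (piTilde L))

/-- The class of `π_μ` in the coordinate ring. -/
def coordX (μ : YoungDiagram) : CoordRing := Ideal.Quotient.mk pluckerIdeal (MvPolynomial.X μ)

theorem coord_comp_perm {k n : ℕ} (L : Fin k → Idx k n) (σ : Equiv.Perm (Fin k)) :
    coord (L ∘ σ) = (Equiv.Perm.sign σ : ℤˣ) • coord L := by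
  rw [coord, coord, piTilde_comp_perm, map_mul, map_mul, map_intCast, map_intCast, Units.smul_def,
    zsmul_eq_mul]

theorem neg_one_pow_mul_self {R : Type*} [CommRing R] (j : ℕ) : (-1 : R) ^ j * (-1) ^ j = 1 := by
  rw [← mul_pow]; simp

theorem eq_of_neg_one_mul_mul_add_eq_zero {R : Type*} [CommRing R] {a b s : R}
    (h : -1 * a * b + s = 0) : a * b = s := by
  linear_combination -h

/-- This is the Plücker relation for `I` equal to `L` without its last entry and `J` equal to that
entry followed by `M`. Moving the entry into place `j` of `M` costs the sign of a cycle, which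
cancels the alternating sign. -/
theorem coord_mul_coord_last {m n : ℕ} (h : m + 1 ≤ n) (L M : Fin (m + 1) → Idx (m + 1) n) :
    coord L * coord M = ∑ j, coord (Function.update L (Fin.last m) (M j)) *
      coord (Function.update M j (L (Fin.last m))) := by
  have key := Ideal.Quotient.eq_zero_iff_mem.2 (incl_pluckerForm_mem h (Fin.init L)
    (Fin.cons (α := fun _ => Idx (m + 1) n) (L (Fin.last m)) M))
  have hsnoc : ∀ x, Fin.snoc (α := fun _ => Idx (m + 1) n) (Fin.init L) x =
      Function.update L (Fin.last m) x := by
    intro x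
    conv_rhs => rw [← Fin.snoc_init_self L]
    rw [Fin.update_snoc_last]
  have hcons : ∀ j : Fin (m + 1), coord (fun i => (Fin.cons (α := fun _ => Idx (m + 1) n)
      (L (Fin.last m)) M : Fin (m + 2) → Idx (m + 1) n) (j.succ.succAbove i)) =
      (-1) ^ (j : ℕ) * coord (Function.update M j (L (Fin.last m))) := by
    intro j
    have h1 : (fun i => (Fin.cons (α := fun _ => Idx (m + 1) n)
        (L (Fin.last m)) M : Fin (m + 2) → Idx (m + 1) n) (j.succ.succAbove i)) =
        Fin.cons (α := fun _ => Idx (m + 1) n) (L (Fin.last m)) (j.removeNth M) := by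
      funext i
      cases i using Fin.cases <;> simp [Fin.removeNth]
    have h2 : Function.update M j (L (Fin.last m)) =
        (Fin.cons (α := fun _ => Idx (m + 1) n) (L (Fin.last m)) (j.removeNth M)) ∘
          j.cycleRange := by
      rw [Fin.cons_comp_cycleRange, Fin.insertNth_removeNth]
    rw [h1, h2, coord_comp_perm, Fin.sign_cycleRange, Units.smul_def, zsmul_eq_mul]
    push_cast
    rw [← mul_assoc]
    exact ((congrArg (· * _) (neg_one_pow_mul_self _)).trans (one_mul _)).symm
  rw [pluckerForm, map_sum, map_sum, Fin.sum_univ_succ] at key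
  simp only [map_mul, map_pow, map_neg, map_one] at key
  change _ * coord _ * coord _ + ∑ j : Fin (m + 1), _ * coord _ * coord _ = 0 at key
  simp only [hcons, hsnoc, Fin.cons_zero, Fin.cons_succ, Fin.succAbove_zero,
    Function.update_eq_self] at key
  rw [Fin.val_zero, zero_add, pow_one] at key
  refine (eq_of_neg_one_mul_mul_add_eq_zero key).trans ?_
  refine Finset.sum_congr rfl fun j _ => ?_
  have hsq : ((-1 : CoordRing) ^ (j : ℕ)) * (-1) ^ (j : ℕ) = 1 := neg_one_pow_mul_self _
  rw [Fin.val_succ]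
  linear_combination (coord (Function.update L (Fin.last m) (M j)) *
    coord (Function.update M j (L (Fin.last m)))) * hsq

/-- The product of two coordinates as a function of the joint tuple of indices. -/
def coordPair {k n : ℕ} (w : Fin k ⊕ Fin k → Idx k n) : CoordRing :=
  coord (w ∘ Sum.inl) * coord (w ∘ Sum.inr)

theorem coordPair_comp_sumCongr {k n : ℕ} (w : Fin k ⊕ Fin k → Idx k n)
    (σ τ : Equiv.Perm (Fin k)) : coordPair (w ∘ Equiv.Perm.sumCongr σ τ) =
      (Equiv.Perm.sign (Equiv.Perm.sumCongr σ τ) : ℤˣ) • coordPair w := by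
  have h1 : (w ∘ Equiv.Perm.sumCongr σ τ) ∘ Sum.inl = (w ∘ Sum.inl) ∘ σ := rfl
  have h2 : (w ∘ Equiv.Perm.sumCongr σ τ) ∘ Sum.inr = (w ∘ Sum.inr) ∘ τ := rfl
  rw [coordPair, h1, h2, coord_comp_perm, coord_comp_perm, Equiv.Perm.sign_sumCongr, mul_smul,
    coordPair, smul_mul_assoc, mul_smul_comm]

theorem coordPair_exchange {k n : ℕ} (h : k ≤ n) (w : Fin k ⊕ Fin k → Idx k n) (i : Fin k) :
    coordPair w = ∑ j : Fin k, coordPair (w ∘ Equiv.swap (Sum.inl i) (Sum.inr j)) := by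
  obtain _ | m := k
  · exact i.elim0
  have hlast : ∀ v : Fin (m + 1) ⊕ Fin (m + 1) → Idx (m + 1) n, coordPair v =
      ∑ j : Fin (m + 1), coordPair (v ∘ Equiv.swap (Sum.inl (Fin.last m)) (Sum.inr j)) := by
    intro v
    rw [coordPair, coord_mul_coord_last h]
    refine Finset.sum_congr rfl fun j _ => ?_
    rw [coordPair]
    congr 2
    · funext a
      by_cases ha : a = Fin.last m
      · subst ha; simp
      · simp [ha, Equiv.swap_apply_of_ne_of_ne]
    · funext a
      by_cases ha : a = j
      · subst ha; simp
      · simp [ha, Equiv.swap_apply_of_ne_of_ne]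
  -- Conjugation by `c` transfers the exchange from the last position to `i`; its sign cancels from
  -- both sides.
  set c : Equiv.Perm (Fin (m + 1) ⊕ Fin (m + 1)) :=
    Equiv.Perm.sumCongr (Equiv.swap i (Fin.last m)) 1 with hc
  have h1 := hlast (w ∘ c)
  have h2 : ∀ j, (w ∘ c) ∘ Equiv.swap (Sum.inl (Fin.last m)) (Sum.inr j) =
      (w ∘ Equiv.swap (Sum.inl i) (Sum.inr j)) ∘ c := by
    intro j
    have := Equiv.mul_swap_eq_swap_mul c (Sum.inl (Fin.last m)) (Sum.inr j)
    have h3 : c (Sum.inl (Fin.last m)) = Sum.inl i := by simp only [hc, Equiv.Perm.sumCongr_apply, Sum.map_inl, Equiv.swap_apply_right]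
    have h4 : c (Sum.inr j) = Sum.inr j := by simp only [hc, Equiv.Perm.sumCongr_apply, Sum.map_inr, Equiv.Perm.one_apply]
    rw [h3, h4] at this
    rw [Function.comp_assoc, Function.comp_assoc, ← Equiv.Perm.coe_mul, ← Equiv.Perm.coe_mul, this]
  simp only [h2] at h1
  simp only [hc, coordPair_comp_sumCongr, ← Finset.smul_sum] at h1
  exact smul_left_cancel _ h1

/-! ### Straightening a product of two coordinates -/

theorem card_eq_sum_rowLen {k : ℕ} {μ : YoungDiagram} (h : μ.colLen 0 ≤ k) :
    μ.card = ∑ r : Fin k, μ.rowLen r := by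
  rw [Fin.sum_univ_eq_sum_range, YoungDiagram.card,
    Finset.card_eq_sum_card_fiberwise (f := Prod.fst) (t := Finset.range k)]
  · refine Finset.sum_congr rfl fun r _ => ?_
    rw [YoungDiagram.rowLen_eq_card, YoungDiagram.row]
  · intro c hc
    have h1 : (c.1, 0) ∈ μ := μ.up_left_mem le_rfl (Nat.zero_le _) (YoungDiagram.mem_cells c |>.1 hc)
    exact Finset.mem_coe.2 (Finset.mem_range.2 ((YoungDiagram.mem_iff_lt_colLen.1 h1).trans_le h))

theorem card_partition {k n : ℕ} {L : Fin k → Idx k n} (hL : Function.Injective L) :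
    ((partition L hL).card : ℤ) = ∑ i, (L i : ℤ) + ∑ i : Fin k, ((i : ℕ) + 1 : ℤ) := by
  rw [card_eq_sum_rowLen (colLen_partition_le hL), Nat.cast_sum,
    ← Equiv.sum_comp (Tuple.sort L) fun i => (L i : ℤ),
    ← Equiv.sum_comp Fin.revPerm fun i => (L (Tuple.sort L i) : ℤ), ← Finset.sum_add_distrib]
  refine Finset.sum_congr rfl fun i _ => ?_
  rw [rowLen_partition, part_eq hL, add_assoc]
  rfl

theorem coord_eq_or {k n : ℕ} (L : Fin k → Idx k n) : coord L = 0 ∨ ∃ (μ : YoungDiagram) (c : ℤ),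
    coord L = c • coordX μ ∧ (μ.card : ℤ) = ∑ i, (L i : ℤ) + ∑ i : Fin k, ((i : ℕ) + 1 : ℤ) := by
  by_cases hL : Function.Injective L
  · refine Or.inr ⟨partition L hL, (Equiv.Perm.sign (Tuple.sort L) : ℤˣ), ?_, card_partition hL⟩
    rw [coord, incl_piTilde hL, map_mul, map_intCast, zsmul_eq_mul]
    rfl
  · left
    rw [coord, piTilde_of_not_injective hL, map_zero, map_zero]

/-- The increasing tuple of indices of a partition in the box. -/
def indexTuple {k n : ℕ} (μ : YoungDiagram) (h : μ.rowLen 0 + k ≤ n) (i : Fin k) : Idx k n :=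
  ⟨(μ.rowLen i.rev : ℤ) + i - k, by
    have h1 := μ.rowLen_anti 0 i.rev (Nat.zero_le _)
    have h2 := i.2
    constructor <;> omega⟩

theorem indexTuple_strictMono {k n : ℕ} (μ : YoungDiagram) (h : μ.rowLen 0 + k ≤ n) :
    StrictMono (indexTuple (k := k) μ h) := by
  intro i j hij
  have h1 := μ.rowLen_anti j.rev i.rev (Fin.rev_le_rev.2 hij.le)
  have h2 : (i : ℕ) < j := hij
  rw [← Subtype.coe_lt_coe]
  simp only [indexTuple]
  omega

theorem coord_indexTuple {k n : ℕ} {μ : YoungDiagram} (hk : μ.colLen 0 ≤ k)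
    (h : μ.rowLen 0 + k ≤ n) : coord (indexTuple (k := k) μ h) = coordX μ := by
  have hL := (indexTuple_strictMono (k := k) μ h).injective
  have hsort : Tuple.sort (indexTuple (k := k) μ h) = 1 :=
    Tuple.sort_eq_refl_iff_monotone.2 (indexTuple_strictMono μ h).monotone
  have hpart : partition (indexTuple (k := k) μ h) hL = μ := by
    refine eq_of_rowLen_eq fun r => ?_
    rcases lt_or_ge r k with hr | hr
    · have h1 := rowLen_partition hL ⟨r, hr⟩
      rw [h1]
      have h2 := part_eq hL ⟨r, hr⟩
      simp only [increasing, hsort, Equiv.Perm.coe_one, Function.comp_id, indexTuple, Fin.rev_rev,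
        Fin.val_rev] at h2
      omega
    · rw [rowLen_eq_zero_iff.2 (hk.trans hr),
        rowLen_eq_zero_iff.2 ((colLen_partition_le hL).trans hr)]
  rw [coord, incl_piTilde hL, hpart, hsort]
  simp [coordX]

/-- The left positions leaving the left block carry values at least `y`; the equally many, at least
one, right positions replacing them carry values at most `x`. -/
theorem sum_comp_inl_lt_of_not_mapsTo {α β : Type*} [Fintype α] [Fintype β] [DecidableEq α]
    [DecidableEq β] {w : α ⊕ β → ℤ} {P : Finset (α ⊕ β)} {x y : ℤ} (hxy : x < y)
    (hl : ∀ a, Sum.inl a ∈ P → y ≤ w (Sum.inl a)) (hr : ∀ b, Sum.inr b ∈ P → w (Sum.inr b) ≤ x)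
    {τ : Equiv.Perm (α ⊕ β)} (hτ : ∀ z, z ∉ P → τ z = z)
    (hnot : ¬ Set.MapsTo τ (Set.range Sum.inl) (Set.range Sum.inl)) :
    ∑ a : α, w (τ (Sum.inl a)) < ∑ a : α, w (Sum.inl a) := by
  set B : Finset (α ⊕ β) := Finset.univ.map Function.Embedding.inl with hB
  set A : Finset (α ⊕ β) := B.map τ.toEmbedding with hA
  have hBsum : ∑ a : α, w (Sum.inl a) = ∑ z ∈ B, w z := by simp [hB]
  have hAsum : ∑ a : α, w (τ (Sum.inl a)) = ∑ z ∈ A, w z := by simp [hA, hB]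
  have hcard : #(A \ B) = #(B \ A) := Finset.card_sdiff_comm (by simp [hA])
  have hne : (A \ B).Nonempty := by
    simp only [Set.MapsTo, not_forall] at hnot
    obtain ⟨z, ⟨a, rfl⟩, h⟩ := hnot
    refine ⟨τ (Sum.inl a), ?_⟩
    simp only [hA, hB, Finset.mem_sdiff, Finset.mem_map]
    refine ⟨⟨Sum.inl a, ⟨a, Finset.mem_univ a, rfl⟩, rfl⟩, ?_⟩
    rintro ⟨b, -, hb⟩
    exact h ⟨b, hb⟩
  have h1 : ∑ z ∈ A \ B, w z ≤ #(A \ B) • x := by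
    refine Finset.sum_le_card_nsmul _ _ _ fun z hz => ?_
    simp only [hA, hB, Finset.mem_sdiff, Finset.mem_map, Finset.mem_univ, true_and] at hz
    obtain ⟨⟨_, ⟨a, rfl⟩, rfl⟩, hz⟩ := hz
    change ¬ ∃ b, Sum.inl b = τ (Sum.inl a) at hz
    change w (τ (Sum.inl a)) ≤ x
    rcases hb : τ (Sum.inl a) with b | b
    · exact absurd ⟨b, hb.symm⟩ hz
    · refine hr b ?_
      by_contra hP
      have h2 := hτ _ hP
      rw [← hb] at h2
      have h3 := τ.injective h2
      rw [hb] at h3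
      cases h3
  have h2 : #(B \ A) • y ≤ ∑ z ∈ B \ A, w z := by
    refine Finset.card_nsmul_le_sum _ _ _ fun z hz => ?_
    simp only [hA, hB, Finset.mem_sdiff, Finset.mem_map, Finset.mem_univ, true_and] at hz
    obtain ⟨⟨a, rfl⟩, hz⟩ := hz
    refine hl a ?_
    by_contra hP
    exact hz ⟨Sum.inl a, ⟨a, rfl⟩, hτ _ hP⟩
  have h3 : #(A \ B) • x < #(B \ A) • y := by
    rw [← hcard]
    exact nsmul_lt_nsmul_right (Finset.card_pos.2 hne).ne' hxy
  have h4 := Finset.sum_sdiff_sub_sum_sdiff (s₁ := A) (s₂ := B) (f := w)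
  rw [hBsum, hAsum]
  linarith

/-- The products of two coordinates whose partitions have the same total size as `μ` and `ν`, the
first one being smaller than `μ`. -/
def spreadProducts (μ ν : YoungDiagram) : Set CoordRing :=
  {y | ∃ μ' ν', y = coordX μ' * coordX ν' ∧ μ'.card + ν'.card = μ.card + ν.card ∧ μ'.card < μ.card}

/-- In the vanishing antisymmetrization, permutations preserving the two blocks each reproduce the
product itself; all others lower the index sum on the left, that is, the size of the first
partition. -/
theorem coordX_mul_coordX_mem_span {μ ν : YoungDiagram} (h : ¬ μ ≤ ν) :
    coordX μ * coordX ν ∈ Submodule.span ℂ (spreadProducts μ ν) := by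
  rw [le_iff_rowLen_le] at h
  push Not at h
  obtain ⟨r, hr⟩ := h
  obtain ⟨k, hkμ, hkν⟩ : ∃ k, μ.colLen 0 ≤ k ∧ ν.colLen 0 ≤ k :=
    ⟨_, le_max_left _ _, le_max_right _ _⟩
  obtain ⟨n, hnμ, hnν⟩ : ∃ n, μ.rowLen 0 + k ≤ n ∧ ν.rowLen 0 + k ≤ n :=
    ⟨_, le_max_left _ _, le_max_right _ _⟩
  have hrk : r < k := (rowLen_pos_iff.1 (Nat.zero_lt_of_lt hr)).trans_le hkμ
  set L : Fin k → Idx k n := indexTuple μ hnμ with hL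
  set M : Fin k → Idx k n := indexTuple ν hnν with hM
  set i : Fin k := Fin.rev ⟨r, hrk⟩ with hi
  have hML : (M i : ℤ) < L i := by
    simp only [hL, hM, indexTuple, hi, Fin.rev_rev]
    omega
  set w : Fin k ⊕ Fin k → Idx k n := Sum.elim L M with hw
  -- These are `k + 1` positions, one more than the right block has. As `M i < L i` and both tuples
  -- increase, every left index in `P` exceeds every right one.
  set P : Finset (Fin k ⊕ Fin k) := (Finset.Ici i).disjSum (Finset.Iic i) with hP
  have hcardP : Fintype.card (Fin k) < P.card := by
    rw [hP, Finset.card_disjSum, Fin.card_Ici, Fin.card_Iic, Fintype.card_fin]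
    have := i.2
    omega
  have hpair : coordPair w = coordX μ * coordX ν := by
    rw [← coord_indexTuple hkμ hnμ, ← coord_indexTuple hkν hnν]
    rfl
  have hcardL : (μ.card : ℤ) = ∑ a, (L a : ℤ) + ∑ a : Fin k, ((a : ℕ) + 1 : ℤ) := by
    rw [card_eq_sum_rowLen hkμ, ← Equiv.sum_comp Fin.revPerm fun a => (L a : ℤ),
      ← Finset.sum_add_distrib, Nat.cast_sum]
    refine Finset.sum_congr rfl fun a _ => ?_
    simp only [hL, indexTuple, Fin.revPerm_apply, Fin.rev_rev, Fin.val_rev]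
    omega
  have hcardM : (ν.card : ℤ) = ∑ a, (M a : ℤ) + ∑ a : Fin k, ((a : ℕ) + 1 : ℤ) := by
    rw [card_eq_sum_rowLen hkν, ← Equiv.sum_comp Fin.revPerm fun a => (M a : ℤ),
      ← Finset.sum_add_distrib, Nat.cast_sum]
    refine Finset.sum_congr rfl fun a _ => ?_
    simp only [hM, indexTuple, Fin.revPerm_apply, Fin.rev_rev, Fin.val_rev]
    omega
  have hzero := antisymmetrize_eq_zero ℂ
    (coordPair_exchange ((Nat.le_add_left k _).trans hnμ)) hcardP w
  have hlow : ∀ τ : Equiv.Perm (Fin k ⊕ Fin k), (∀ z, z ∉ P → τ z = z) →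
      ¬ Set.MapsTo τ (Set.range Sum.inl) (Set.range Sum.inl) →
      (Equiv.Perm.sign τ : ℤˣ) • coordPair (w ∘ τ) ∈ Submodule.span ℂ (spreadProducts μ ν) := by
    intro τ hτ hnot
    have hlt := sum_comp_inl_lt_of_not_mapsTo (w := fun z => (w z : ℤ)) hML
      (fun a ha => by
        have ha' : i ≤ a := by simpa [hP] using ha
        exact Subtype.coe_le_coe.2 ((indexTuple_strictMono μ hnμ).monotone ha'))
      (fun b hb => by
        have hb' : b ≤ i := by simpa [hP] using hb
        exact Subtype.coe_le_coe.2 ((indexTuple_strictMono ν hnν).monotone hb')) hτ hnot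
    have htot := Equiv.sum_comp τ fun z => (w z : ℤ)
    rw [Fintype.sum_sum_type, Fintype.sum_sum_type] at htot
    rw [Units.smul_def]
    refine zsmul_mem ?_ _
    rw [coordPair]
    rcases coord_eq_or ((w ∘ τ) ∘ Sum.inl) with h1 | ⟨μ', c, h1, hμ'⟩
    · rw [h1, zero_mul]
      exact zero_mem _
    rcases coord_eq_or ((w ∘ τ) ∘ Sum.inr) with h2 | ⟨ν', d, h2, hν'⟩
    · rw [h2, mul_zero]
      exact zero_mem _
    rw [h1, h2, smul_mul_smul_comm]
    refine zsmul_mem (Submodule.subset_span ?_) _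
    refine ⟨μ', ν', rfl, ?_, ?_⟩
    · zify
      rw [hμ', hν', hcardL, hcardM]
      simp only [Function.comp, hw, Sum.elim_inl, Sum.elim_inr] at htot ⊢
      linarith
    · zify
      rw [hμ', hcardL]
      simp only [Function.comp, hw, Sum.elim_inl] at hlt ⊢
      linarith
  have hkeep : ∀ τ : Equiv.Perm (Fin k ⊕ Fin k),
      Set.MapsTo τ (Set.range Sum.inl) (Set.range Sum.inl) →
      (Equiv.Perm.sign τ : ℤˣ) • coordPair (w ∘ τ) = coordPair w := by
    intro τ hτ
    obtain ⟨⟨σ₁, σ₂⟩, rfl⟩ := Equiv.Perm.mem_sumCongrHom_range_of_perm_mapsTo_inl hτ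
    rw [Equiv.Perm.sumCongrHom_apply, coordPair_comp_sumCongr, smul_smul, Int.units_mul_self,
      one_smul]
  classical
  rw [antisymmetrize, ← Finset.sum_filter_add_sum_filter_not _
    fun τ : Equiv.Perm (Fin k ⊕ Fin k) => Set.MapsTo τ (Set.range Sum.inl) (Set.range Sum.inl),
    Finset.sum_congr rfl fun τ hτ => hkeep τ (Finset.mem_filter.1 hτ).2, Finset.sum_const,
    add_eq_zero_iff_eq_neg, ← Nat.cast_smul_eq_nsmul ℂ] at hzero
  rw [← hpair]
  refine (Submodule.smul_mem_iff _ (Nat.cast_ne_zero.2 ?_)).1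
    (hzero ▸ neg_mem (Submodule.sum_mem _ fun τ hτ => ?_))
  · refine Finset.card_ne_zero_of_mem (a := 1) ?_
    simp [Set.MapsTo]
  · rw [Finset.mem_filter, Finset.mem_filter] at hτ
    exact hlow τ hτ.1.2 hτ.2

/-! ### Standard monomials span -/

/-- The class of a monomial in the coordinate ring. -/
def coordMonomial (m : Multiset YoungDiagram) : CoordRing :=
  Ideal.Quotient.mk pluckerIdeal (m.map MvPolynomial.X).prod

theorem coordMonomial_cons (μ : YoungDiagram) (m : Multiset YoungDiagram) :
    coordMonomial (μ ::ₘ m) = coordX μ * coordMonomial m := by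
  rw [coordMonomial, Multiset.map_cons, Multiset.prod_cons, map_mul]
  rfl

theorem sum_map_sq_le_sq_sum_map {ι : Type*} (f : ι → ℕ) (m : Multiset ι) :
    (m.map fun i => f i ^ 2).sum ≤ (m.map f).sum ^ 2 := by
  induction m using Multiset.induction_on with
  | empty => simp
  | cons a m ih =>
    simp only [Multiset.map_cons, Multiset.sum_cons]
    nlinarith [Nat.zero_le (f a * (m.map f).sum)]

/-- The span of the standard monomials. -/
def standardSpan : Submodule ℂ CoordRing :=
  Submodule.span ℂ (Set.range fun m : {m : Multiset YoungDiagram // IsStandard m} =>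
    coordMonomial m.1)

/-- Straightening with the smaller partition first keeps the total size and strictly increases the
sum of squared sizes, which is at most the square of the total. -/
theorem coordMonomial_mem_standardSpan (m : Multiset YoungDiagram) :
    coordMonomial m ∈ standardSpan := by
  induction hN : (m.map YoungDiagram.card).sum ^ 2 - (m.map fun μ => μ.card ^ 2).sum
    using Nat.strong_induction_on generalizing m with
  | _ N ih =>
  by_cases hm : IsStandard m
  · exact Submodule.subset_span ⟨⟨m, hm⟩, rfl⟩
  obtain ⟨μ, hμ, ν, hν, hcard, hle⟩ : ∃ μ ∈ m, ∃ ν ∈ m, μ.card ≤ ν.card ∧ ¬ μ ≤ ν := by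
    simp only [IsStandard, not_forall, not_or] at hm
    obtain ⟨μ, hμ, ν, hν, h1, h2⟩ := hm
    rcases le_total μ.card ν.card with h | h
    · exact ⟨μ, hμ, ν, hν, h, h1⟩
    · exact ⟨ν, hν, μ, hμ, h, h2⟩
  obtain ⟨t, rfl⟩ := Multiset.exists_cons_of_mem hμ
  have hνt : ν ∈ t := (Multiset.mem_cons.1 hν).resolve_left (by rintro rfl; exact hle le_rfl)
  obtain ⟨t, rfl⟩ := Multiset.exists_cons_of_mem hνt
  rw [coordMonomial_cons, coordMonomial_cons, ← mul_assoc]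
  have hspan : Submodule.span ℂ (spreadProducts μ ν) ≤
      standardSpan.comap (LinearMap.mulRight ℂ (coordMonomial t)) := by
    refine Submodule.span_le.2 ?_
    rintro _ ⟨μ', ν', rfl, hsum, hlt⟩
    change coordX μ' * coordX ν' * coordMonomial t ∈ standardSpan
    rw [mul_assoc, ← coordMonomial_cons, ← coordMonomial_cons]
    refine ih _ ?_ _ rfl
    -- This bound keeps the natural subtraction in the measure from truncating, so the measure
    -- really drops.
    have hbound := sum_map_sq_le_sq_sum_map YoungDiagram.card (μ' ::ₘ ν' ::ₘ t)
    have hsq : μ.card ^ 2 + ν.card ^ 2 < μ'.card ^ 2 + ν'.card ^ 2 := by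
      obtain ⟨d, hd⟩ := Nat.exists_eq_add_of_lt hlt
      obtain ⟨e, he⟩ := Nat.exists_eq_add_of_le hcard
      have h1 : ν'.card = μ'.card + d + 1 + e + d + 1 := by omega
      rw [h1, he, hd]
      nlinarith [Nat.zero_le (d * e), Nat.zero_le (d * d)]
    simp only [Multiset.map_cons, Multiset.sum_cons, ← add_assoc] at hbound hN ⊢
    rw [hsum] at hbound ⊢
    omega
  exact hspan (coordX_mul_coordX_mem_span hle)

theorem standardSpan_eq_top : standardSpan = ⊤ := by
  refine eq_top_iff.2 fun y _ => ?_
  obtain ⟨p, rfl⟩ := Ideal.Quotient.mk_surjective y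
  induction p using MvPolynomial.induction_on with
  | C a =>
    have h := standardSpan.smul_mem a (coordMonomial_mem_standardSpan 0)
    have h1 : a • coordMonomial 0 = Ideal.Quotient.mk pluckerIdeal (MvPolynomial.C a) := by
      rw [coordMonomial, Multiset.map_zero, Multiset.prod_zero, ← MvPolynomial.algebraMap_eq,
        Algebra.algebraMap_eq_smul_one]
      rfl
    rwa [h1] at h
  | add p q hp hq =>
    rw [map_add]
    exact add_mem (hp trivial) (hq trivial)
  | mul_X p μ hp =>
    have h : standardSpan ≤ standardSpan.comap (LinearMap.mulRight ℂ (coordX μ)) := by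
      refine Submodule.span_le.2 ?_
      rintro _ ⟨m, rfl⟩
      change coordMonomial m.1 * coordX μ ∈ standardSpan
      rw [mul_comm, ← coordMonomial_cons]
      exact coordMonomial_mem_standardSpan _
    rw [map_mul]
    exact h (hp trivial)

/-! ### Embedding into a domain -/

/-- The embedding of the coordinate ring induced by the parametrization of the big cell. -/
def coordMap : CoordRing →ₐ[ℂ] CellRing :=
  Ideal.Quotient.liftₐ pluckerIdeal cellMap fun _ h => pluckerIdeal_le_ker h

theorem coordMap_injective : Function.Injective coordMap := by
  rw [injective_iff_map_eq_zero]
  intro y hy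
  have hmem : y ∈ standardSpan := standardSpan_eq_top ▸ Submodule.mem_top
  rw [standardSpan, Finsupp.mem_span_range_iff_exists_finsupp] at hmem
  obtain ⟨c, rfl⟩ := hmem
  have h := linearIndependent_iff.1 linearIndependent_standard c
  rw [h, Finsupp.sum_zero_index]
  rw [Finsupp.linearCombination_apply, ← hy, Finsupp.sum, Finsupp.sum, map_sum]
  refine Finset.sum_congr rfl fun m _ => ?_
  rw [map_smul]
  rfl

theorem isDomain_coordRing : IsDomain CoordRing :=
  coordMap_injective.isDomain coordMap.toRingHom

end InfGrassmannian

end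

theorem mainTheorem9 :
    InfGrassmannian.pluckerIdeal.IsPrime ∧ IsDomain InfGrassmannian.CoordRing :=
  ⟨(Ideal.Quotient.isDomain_iff_prime _).1 InfGrassmannian.isDomain_coordRing,
    InfGrassmannian.isDomain_coordRing⟩
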